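/- Let $\epsilon>0$ be real and let $k\ge 1$, $n$ be integers. Let $\Delta_k=\{p\in\mathbb R^k: p_i\ge 0,\ \sum_{i=1}^k p_i=1\}$, and for $u,v\in\mathbb R^k$ let $\ell_2^2(u,v)=\sum_{i=1}^k (u_i-v_i)^2$ and $\ell_1(u,v)=\sum_{i=1}^k |u_i-v_i|$. A privatization mechanism $Q:\{1,\dots,k\}\to\mathcal Y$ is a family of probability measures $Q(\cdot\mid 1),\dots,Q(\cdot\mid k)$ on a measurable space $\mathcal Y$, which may be arbitrary. It is $\epsilon$-locally differentially private if $Q(S\mid x)\le e^{\epsilon}\,Q(S\mid x')$ for all $x,x'\in\{1,\dots,k\}$ and all measurable $S\subseteq\mathcal Y$; let $\mathcal D_\epsilon$ be the class of all such mechanisms, over all measurable spaces $\mathcal Y$. For $p\in\Delta_k$ let $pQ=\sum_{i=1}^k p_i\,Q(\cdot\mid i)$, and let $(pQ)^n$ be its $n$-fold product measure on $\mathcal Y^n$. For $\ell\in\{\ell_2^2,\ell_1\}$ define the $\epsilon$-private minimax risk $$r^{\ell}_{\epsilon,k,n}=\inf_{Q\in\mathcal D_\epsilon}\ \inf_{\hat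 p}\ \sup_{p\in\Delta_k}\ \mathbb E_{Y^n\sim (pQ)^n}\,\ell(\hat p(Y^n),p),$$ where $\hat p$ ranges over all measurable functions $\mathcal Y^n\to\mathbb R^k$ and the expectation takes values in $[0,\infty]$. **Theorem.** Suppose that $$n>\max\Big(\frac{k^2(e^{\epsilon}+1)^2}{16(e^{\epsilon}-1)^2},\ \frac{k^2}{2(e^{\epsilon}-1)}\Big).$$ If $e^{\epsilon}<3$, then $$r^{\ell_2^2}_{\epsilon,k,n}\ \ge\ \frac{(k-1)(e^{\epsilon}+1)^2}{512\,n\,(e^{\epsilon}-1)^2}\qquad\text{and}\qquad r^{\ell_1}_{\epsilon,k,n}\ \ge\ \frac{(k-1)(e^{\epsilon}+1)}{64\sqrt n\,(e^{\epsilon}-1)}.$$ If $e^{\epsilon}\ge 3$, then $$r^{\ell_2^2}_{\epsilon,k,n}\ \ge\ \frac{k-1}{64\,n\,(e^{\epsilon}-1)}\qquad\text{and}\qquad r^{\ell_1}_{\epsilon,k,n}\ \ge\ \frac{k-1}{16\sqrt{2n(e^{\epsilon}-1)}}.$$ -/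

import Mathlib

open MeasureTheory ProbabilityTheory
open scoped ENNReal

universe u

namespace LocalPrivacy

/-- The squared Euclidean loss `ℓ₂²(u, v) = ∑ᵢ (uᵢ - vᵢ)²` on `ℝᵏ`. -/
def lossL2Sq {k : ℕ} (u v : Fin k → ℝ) : ℝ := ∑ i, (u i - v i) ^ 2

/-- The loss `ℓ₁(u, v) = ∑ᵢ |uᵢ - vᵢ|` on `ℝᵏ`. -/
def lossL1 {k : ℕ} (u v : Fin k → ℝ) : ℝ := ∑ i, |u i - v i|

section Mechanism

variable {k : ℕ} {Y : Type*} [MeasurableSpace Y]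

/-- A mechanism `Q` with input alphabet of size `k` and output space `Y` is `ε`-locally
differentially private: `Q(S|x) / Q(S|x') ≤ e^ε` for all inputs `x`, `x'` and all measurable `S`.
The ratio is cleared of its denominator, so that `0 / 0` is allowed and `c / 0` with `c > 0`
is not. -/
def IsLDP (ε : ℝ) (Q : Kernel (Fin k) Y) : Prop :=
  ∀ x x' : Fin k, ∀ S : Set Y, MeasurableSet S → Q x S ≤ ENNReal.ofReal (Real.exp ε) * Q x' S

/-- The law `m = pQ`, `m(S) = ∑ᵢ Q(S|i) pᵢ`, of one privatized sample. -/
noncomputable def marginal (Q : Kernel (Fin k) Y) (p : Fin k → ℝ) : Measure Y :=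
  ∑ i, ENNReal.ofReal (p i) • Q i

/-- The expected loss `𝔼 ℓ(p̂(Yⁿ), p)` of the estimator `est`, where `Yⁿ` has the `n`-fold
product law `(pQ)ⁿ`; the loss is nonnegative and the expectation is valued in `[0, ∞]`. -/
noncomputable def expectedLoss {n : ℕ} (loss : (Fin k → ℝ) → (Fin k → ℝ) → ℝ)
    (Q : Kernel (Fin k) Y) (est : (Fin n → Y) → (Fin k → ℝ)) (p : Fin k → ℝ) : ℝ≥0∞ :=
  ∫⁻ y, ENNReal.ofReal (loss (est y) p) ∂(Measure.pi fun _ : Fin n => marginal Q p)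

/-- The minimax risk of the mechanism `Q` with `n` samples: infimum over all measurable
estimators, supremum over all `p` in the probability simplex. -/
noncomputable def minimaxRisk (n : ℕ) (loss : (Fin k → ℝ) → (Fin k → ℝ) → ℝ)
    (Q : Kernel (Fin k) Y) : ℝ≥0∞ :=
  ⨅ (est : (Fin n → Y) → (Fin k → ℝ)) (_ : Measurable est),
    ⨆ p ∈ stdSimplex ℝ (Fin k), expectedLoss loss Q est p

end Mechanism

/-- The `ε`-private minimax risk: infimum of the minimax risk over all `ε`-locally differentially
private mechanisms (Markov kernels) into arbitrary measurable spaces. -/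
noncomputable def privateMinimaxRisk (ε : ℝ) (k n : ℕ)
    (loss : (Fin k → ℝ) → (Fin k → ℝ) → ℝ) : ℝ≥0∞ :=
  ⨅ (Y : Type u) (_ : MeasurableSpace Y) (Q : Kernel (Fin k) Y) (_ : IsMarkovKernel Q)
    (_ : IsLDP ε Q), minimaxRisk n loss Q

end LocalPrivacy

/-! Assouad's method, with the private channel entering through one pointwise inequality. Perturb
the uniform distribution by `±δ` along disjoint pairs `(a j, b j)` of symbols, one sign bit per
pair. Flipping bit `j` moves two coordinates by `2δ`, so an estimator pays in proportion to how much
the output laws at the two vertices overlap.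

If `q i` are densities of the channel, the flip changes the output density by `2δ (q (a j) - q (b
j))`, while the density is at least `∑ q / (2k)`. The total triangular discrimination over `j` is
therefore governed by `k ∑ (q (a j) - q (b j))² ≤ A (∑ q)²`. Privacy supplies `A`: `(E - 1) / 4` in
general and `2 (E - 1)² / (E + 1)²` for `E ≤ 3`, where `E = exp ε` (`mul_sum_sq_sub_le`,
`mul_sum_sq_sub_le_of_le_three`). Le Cam's inequality and tensorization of the Hellinger affinity
(`le_integral_min_prod`) turn this into overlap of the `n`-fold products, and `le_minimaxRisk`
assembles the bound. Finally `δ` is taken so that `n * (4 * δ ^ 2 * A) = 1 / 8`. -/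

namespace LocalPrivacy

/-! ### Densities of a private mechanism. -/

section Density

variable {Y : Type*} [MeasurableSpace Y]

/-- A finite product of measures with density is the product measure with the product density. -/
lemma pi_withDensity_ofReal {ι : Type*} [Fintype ι] (μ : Measure Y) [SigmaFinite μ] {p : Y → ℝ}
    (h0 : ∀ y, 0 ≤ p y) (hi : Integrable p μ) :
    Measure.pi (fun _ : ι => μ.withDensity fun y => ENNReal.ofReal (p y)) =
      (Measure.pi fun _ : ι => μ).withDensity fun y => ENNReal.ofReal (∏ i, p (y i)) := by
  have : IsFiniteMeasure (μ.withDensity fun y => ENNReal.ofReal (p y)) :=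
    isFiniteMeasure_withDensity_ofReal hi.2
  refine Measure.pi_eq fun s hs => ?_
  rw [withDensity_apply _ (MeasurableSet.univ_pi hs), Measure.restrict_pi_pi,
    ← ofReal_integral_eq_lintegral_ofReal (Integrable.fintype_prod fun i => hi.restrict)
      (Filter.Eventually.of_forall fun y => Finset.prod_nonneg fun i _ => h0 _),
    integral_fintype_prod_eq_prod (fun _ : ι => p),
    ENNReal.ofReal_prod_of_nonneg fun i _ => integral_nonneg h0]
  refine Finset.prod_congr rfl fun i _ => ?_
  rw [withDensity_apply _ (hs i), ofReal_integral_eq_lintegral_ofReal hi.restrict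
    (Filter.Eventually.of_forall h0)]

/-- A finite family of finite measures with pairwise bounded ratios has densities, with respect to
a common finite measure, whose ratios are bounded everywhere. -/
lemma exists_density {k : ℕ} {E : ℝ} (ν : Fin k → Measure Y) [∀ i, IsFiniteMeasure (ν i)]
    (hE : 0 ≤ E)
    (h : ∀ x x' : Fin k, ∀ S : Set Y, MeasurableSet S → ν x S ≤ ENNReal.ofReal E * ν x' S) :
    ∃ (μ : Measure Y) (q : Fin k → Y → ℝ), IsFiniteMeasure μ ∧ (∀ i, Measurable (q i)) ∧
      (∀ i y, 0 ≤ q i y) ∧ (∀ i j y, q i y ≤ E * q j y) ∧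
      ∀ i, ν i = μ.withDensity fun y => ENNReal.ofReal (q i y) := by
  set μ : Measure Y := ∑ i, ν i with hμ
  have hac : ∀ i, ν i ≪ μ := fun i =>
    Measure.absolutelyContinuous_of_le (by
      rw [hμ]; exact Finset.single_le_sum (fun _ _ => Measure.zero_le _) (Finset.mem_univ i))
  set f : Fin k → Y → ℝ≥0∞ := fun i => (ν i).rnDeriv μ with hf
  have hfm : ∀ i, Measurable (f i) := fun i => Measure.measurable_rnDeriv _ _
  have hfν : ∀ i, μ.withDensity (f i) = ν i := fun i => Measure.withDensity_rnDeriv_eq _ _ (hac i)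
  -- The derivatives satisfy the ratio bound only almost everywhere. Setting all of them to zero off
  -- the conull set `G` makes it hold at every point.
  set G : Set Y := {y | ∀ i, f i y ≠ ∞} ∩ {y | ∀ i j, f i y ≤ ENNReal.ofReal E * f j y} with hG
  have hGm : MeasurableSet G := by
    rw [hG, Set.ofPred_forall, Set.ofPred_forall]
    refine (MeasurableSet.iInter fun i => ?_).inter (MeasurableSet.iInter fun i => ?_)
    · exact (measurableSet_eq_fun (hfm i) measurable_const).compl
    · rw [Set.ofPred_forall]
      exact MeasurableSet.iInter fun j => measurableSet_le (hfm i) ((hfm j).const_mul _)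
  have hGae : ∀ᵐ y ∂μ, y ∈ G := by
    have h1 : ∀ᵐ y ∂μ, ∀ i, f i y ≠ ∞ := ae_all_iff.2 fun i => Measure.rnDeriv_ne_top _ _
    have h2 : ∀ᵐ y ∂μ, ∀ i j, f i y ≤ ENNReal.ofReal E * f j y := by
      refine ae_all_iff.2 fun i => ae_all_iff.2 fun j => ?_
      refine ae_le_of_forall_setLIntegral_le_of_sigmaFinite (hfm i) fun s hs _ => ?_
      rw [lintegral_const_mul _ (hfm j), ← withDensity_apply _ hs, ← withDensity_apply _ hs,
        hfν, hfν]
      exact h i j s hs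
    filter_upwards [h1, h2] with y hy1 hy2 using ⟨hy1, hy2⟩
  refine ⟨μ, fun i => G.indicator fun y => (f i y).toReal, by rw [hμ]; infer_instance,
    fun i => (hfm i).ennreal_toReal.indicator hGm,
    fun i y => Set.indicator_nonneg (fun _ _ => ENNReal.toReal_nonneg) y, fun i j y => ?_,
    fun i => ?_⟩
  · by_cases hy : y ∈ G
    · simp only [Set.indicator_of_mem hy]
      have := ENNReal.toReal_mono (ENNReal.mul_ne_top ENNReal.ofReal_ne_top (hy.1 j)) (hy.2 i j)
      rwa [ENNReal.toReal_mul, ENNReal.toReal_ofReal hE] at this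
    · simp [Set.indicator_of_notMem hy]
  · rw [← hfν i]
    refine withDensity_congr_ae ?_
    filter_upwards [hGae] with y hy
    simp only [Set.indicator_of_mem hy]
    rw [ENNReal.ofReal_toReal (hy.1 i)]

end Density

/-! ### Hellinger affinity, triangular discrimination and overlap. -/

section Affinity

lemma sq_sub_div_add_le {a b : ℝ} (ha : 0 ≤ a) (hb : 0 ≤ b) : (a - b) ^ 2 / (a + b) ≤ a + b := by
  refine div_le_of_le_mul₀ (by positivity) (by positivity) ?_
  nlinarith [mul_nonneg ha hb]

/-- The left side is `4ab / (a + b)`, twice the harmonic mean, compared with twice the geometric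
mean. -/
lemma add_sub_div_le_two_mul_sqrt {a b : ℝ} (ha : 0 ≤ a) (hb : 0 ≤ b) :
    a + b - (a - b) ^ 2 / (a + b) ≤ 2 * √(a * b) := by
  rcases (add_nonneg ha hb).eq_or_lt with h | h
  · rw [← h]; simp
  rw [sub_le_iff_le_add, ← sub_le_iff_le_add', le_div_iff₀ h]
  have hs := Real.sq_sqrt (mul_nonneg ha hb)
  have h2 : 2 * √(a * b) ≤ a + b :=
    abs_le_of_sq_le_sq' (by nlinarith [sq_nonneg (a - b)]) h.le |>.2
  nlinarith [mul_nonneg (Real.sqrt_nonneg (a * b)) (sub_nonneg.2 h2)]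

/-- The weighted arithmetic-geometric inequality in terms of the minimum. -/
lemma two_mul_mul_sqrt_le {a b t : ℝ} (ha : 0 ≤ a) (hb : 0 ≤ b) :
    2 * t * √(a * b) ≤ 2 * min a b + t ^ 2 / 2 * (a + b) := by
  have hs := Real.sq_sqrt (mul_nonneg ha hb)
  have key : ∀ x y s : ℝ, 0 ≤ x → x ≤ y → s ^ 2 = x * y →
      2 * t * s ≤ 2 * x + t ^ 2 / 2 * (x + y) := by
    intro x y s hx hxy hs
    rcases hx.eq_or_lt with h | h
    · have : s = 0 := by rw [← h, zero_mul] at hs; exact pow_eq_zero_iff two_ne_zero |>.1 hs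
      rw [this, ← h]; nlinarith [mul_nonneg (sq_nonneg t) (hx.trans hxy)]
    · have h1 : 0 ≤ (2 * x - t * s) ^ 2 / (2 * x) := by positivity
      have h2 : (2 * x - t * s) ^ 2 / (2 * x) = 2 * x - 2 * t * s + t ^ 2 / 2 * y := by
        field_simp
        linear_combination t ^ 2 * hs
      nlinarith [mul_nonneg (sq_nonneg t) hx]
  rcases le_total a b with h | h
  · rw [min_eq_left h]; exact key a b _ ha h hs
  · rw [min_eq_right h, add_comm a b]; exact key b a _ hb h (by rw [hs, mul_comm])

variable {Y : Type*} [MeasurableSpace Y] {μ : Measure Y} {p r : Y → ℝ}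

lemma integrable_sqrt_mul (hp0 : ∀ y, 0 ≤ p y) (hr0 : ∀ y, 0 ≤ r y)
    (hp : Integrable p μ) (hr : Integrable r μ) : Integrable (fun y => √(p y * r y)) μ := by
  refine (hp.add hr).mono' ?_ (Filter.Eventually.of_forall fun y => ?_)
  · exact Real.continuous_sqrt.comp_aestronglyMeasurable
      (hp.aestronglyMeasurable.mul hr.aestronglyMeasurable)
  · rw [Real.norm_of_nonneg (Real.sqrt_nonneg _), Pi.add_apply, Real.sqrt_le_left (add_nonneg (hp0 y) (hr0 y))]
    nlinarith [mul_nonneg (hp0 y) (hr0 y), sq_nonneg (p y), sq_nonneg (r y)]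

lemma integrable_sq_sub_div (hp0 : ∀ y, 0 ≤ p y) (hr0 : ∀ y, 0 ≤ r y)
    (hp : Integrable p μ) (hr : Integrable r μ) :
    Integrable (fun y => (p y - r y) ^ 2 / (p y + r y)) μ := by
  refine (hp.add hr).mono' ?_ (Filter.Eventually.of_forall fun y => ?_)
  · exact (((hp.aemeasurable.sub hr.aemeasurable).pow_const 2).div
      (hp.aemeasurable.add hr.aemeasurable)).aestronglyMeasurable
  · have h := add_nonneg (hp0 y) (hr0 y)
    rw [Real.norm_of_nonneg (by positivity)]
    exact sq_sub_div_add_le (hp0 y) (hr0 y)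

/-- Le Cam's inequality: half the squared Hellinger affinity is a lower bound for the overlap of
two probability densities. -/
lemma sq_integral_sqrt_le (hp0 : ∀ y, 0 ≤ p y) (hr0 : ∀ y, 0 ≤ r y)
    (hp : Integrable p μ) (hr : Integrable r μ) (hp1 : ∫ y, p y ∂μ = 1) (hr1 : ∫ y, r y ∂μ = 1) :
    (∫ y, √(p y * r y) ∂μ) ^ 2 ≤ 2 * ∫ y, min (p y) (r y) ∂μ := by
  set t := ∫ y, √(p y * r y) ∂μ with ht
  have hm : Integrable (fun y => min (p y) (r y)) μ := hp.inf hr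
  have hs : Integrable (fun y => p y + r y) μ := hp.add hr
  -- The weight `t` is the affinity itself: integration gives `2t² ≤ 2 ∫ min + t²`.
  have h := integral_mono ((integrable_sqrt_mul hp0 hr0 hp hr).const_mul (2 * t))
    ((hm.const_mul 2).add (hs.const_mul (t ^ 2 / 2)))
    fun y => two_mul_mul_sqrt_le (t := t) (hp0 y) (hr0 y)
  rw [integral_const_mul, ← ht, integral_add' (hm.const_mul 2) (hs.const_mul (t ^ 2 / 2)),
    integral_const_mul, integral_const_mul, integral_add hp hr, hp1, hr1] at h
  nlinarith

/-- Overlap of two `n`-fold product densities in terms of the triangular discrimination of the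
factors. -/
lemma le_integral_min_prod [SigmaFinite μ] (n : ℕ) (hp0 : ∀ y, 0 ≤ p y) (hr0 : ∀ y, 0 ≤ r y)
    (hp : Integrable p μ) (hr : Integrable r μ) (hp1 : ∫ y, p y ∂μ = 1) (hr1 : ∫ y, r y ∂μ = 1) :
    1 - n * ∫ y, (p y - r y) ^ 2 / (p y + r y) ∂μ ≤
      2 * ∫ y, min (∏ i, p (y i)) (∏ i, r (y i)) ∂(Measure.pi fun _ : Fin n => μ) := by
  set t := ∫ y, √(p y * r y) ∂μ with ht
  have ht0 : 0 ≤ t := integral_nonneg fun y => Real.sqrt_nonneg _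
  have hH : 2 - ∫ y, (p y - r y) ^ 2 / (p y + r y) ∂μ ≤ 2 * t := by
    have h := integral_mono ((hp.add hr).sub (integrable_sq_sub_div hp0 hr0 hp hr))
      ((integrable_sqrt_mul hp0 hr0 hp hr).const_mul 2)
      fun y => add_sub_div_le_two_mul_sqrt (hp0 y) (hr0 y)
    rw [integral_sub' (hp.add hr) (integrable_sq_sub_div hp0 hr0 hp hr),
      integral_add' hp hr, hp1, hr1, integral_const_mul] at h
    linarith
  have hpow : (∫ y, √((∏ i, p (y i)) * ∏ i, r (y i)) ∂(Measure.pi fun _ : Fin n => μ)) = t ^ n := by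
    have h := integral_fintype_prod_eq_pow (ι := Fin n) (fun y => √(p y * r y)) (μ := μ)
    rw [Fintype.card_fin] at h
    rw [ht, ← h]
    congr 1 with y
    rw [← Finset.prod_mul_distrib, Real.sqrt_prod _ fun i _ => mul_nonneg (hp0 _) (hr0 _)]
  have hprod : ∀ f : Y → ℝ, (∫ y, f y ∂μ = 1) →
      ∫ y, ∏ i, f (y i) ∂(Measure.pi fun _ : Fin n => μ) = 1 := fun f hf => by
    rw [integral_fintype_prod_eq_pow (ι := Fin n) f, hf, one_pow]
  have h := sq_integral_sqrt_le (μ := Measure.pi fun _ : Fin n => μ)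
    (p := fun y => ∏ i, p (y i)) (r := fun y => ∏ i, r (y i))
    (fun y => Finset.prod_nonneg fun i _ => hp0 _) (fun y => Finset.prod_nonneg fun i _ => hr0 _)
    (Integrable.fintype_prod fun _ => hp) (Integrable.fintype_prod fun _ => hr)
    (hprod p hp1) (hprod r hr1)
  rw [hpow, ← pow_mul] at h
  -- Bernoulli for `t ^ (2n)`, to be combined with `t ≥ 1 - Δ / 2`, where `Δ` is the triangular
  -- discrimination.
  have hb := one_add_mul_le_pow (a := t - 1) (by linarith) (n * 2)
  rw [add_sub_cancel] at hb
  push_cast at hb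
  nlinarith [mul_le_mul_of_nonneg_left hH (Nat.cast_nonneg (α := ℝ) n)]

end Affinity

/-! ### Contrasts of densities with bounded ratios. -/

section Pairs

variable {m k : ℕ} {a b : Fin m → Fin k}

lemma sum_pairs_le (hab : Function.Injective (Sum.elim a b)) {f : Fin k → ℝ} (hf : ∀ i, 0 ≤ f i) :
    ∑ j, (f (a j) + f (b j)) ≤ ∑ i, f i := by
  have h : ∑ j, (f (a j) + f (b j)) = ∑ s : Fin m ⊕ Fin m, f (Sum.elim a b s) := by
    rw [Fintype.sum_sum_type, Finset.sum_add_distrib]; rfl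
  rw [h, ← Finset.sum_image (f := f) (g := Sum.elim a b) fun x _ y _ hxy => hab hxy]
  exact Finset.sum_le_sum_of_subset_of_nonneg (Finset.subset_univ _) fun i _ _ => hf i

/-- The contrasts over disjoint pairs are controlled by the minimum and a total excess `w`. -/
lemma exists_excess (hk : 0 < k) (hab : Function.Injective (Sum.elim a b)) {E : ℝ} {q : Fin k → ℝ}
    (h0 : ∀ i, 0 ≤ q i) (hE : ∀ i j, q i ≤ E * q j) :
    ∃ l w : ℝ, 0 ≤ l ∧ 0 ≤ w ∧ ∑ j, (q (a j) - q (b j)) ^ 2 ≤ (E - 1) * l * w ∧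
      2 * w ≤ (E - 1) * l * k ∧ k * l + w ≤ ∑ i, q i := by
  obtain ⟨i₀, -, hi₀⟩ := Finset.exists_min_image Finset.univ q
    (Finset.univ_nonempty_iff.2 ⟨⟨0, hk⟩⟩)
  set l := q i₀
  have hdiff : ∀ i j, |q i - q j| ≤ (E - 1) * l := fun i j => by
    rw [abs_le]
    constructor <;> linarith [hE i i₀, hE j i₀, hi₀ i (Finset.mem_univ _),
      hi₀ j (Finset.mem_univ _)]
  have hle : 2 * m ≤ k := by
    have := Fintype.card_le_of_injective _ hab
    simp only [Fintype.card_sum, Fintype.card_fin] at this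
    omega
  have hle' : (2 * m : ℝ) ≤ k := by exact_mod_cast hle
  have hEl : 0 ≤ (E - 1) * l := (abs_nonneg _).trans (hdiff i₀ i₀)
  -- Here `l` is the smallest value, so every difference is at most `(E - 1) l`; the factor 2 in the
  -- bound on `w` comes from `2m ≤ k`.
  refine ⟨l, ∑ j, |q (a j) - q (b j)|, h0 _, Finset.sum_nonneg fun _ _ => abs_nonneg _, ?_, ?_, ?_⟩
  · rw [Finset.mul_sum]
    refine Finset.sum_le_sum fun j _ => ?_
    rw [← sq_abs, sq]
    exact mul_le_mul_of_nonneg_right (hdiff _ _) (abs_nonneg _)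
  · have : ∑ j, |q (a j) - q (b j)| ≤ ∑ _j : Fin m, (E - 1) * l :=
      Finset.sum_le_sum fun j _ => hdiff _ _
    rw [Finset.sum_const, Finset.card_univ, Fintype.card_fin, nsmul_eq_mul] at this
    nlinarith
  -- Above the floor `l`, a pair has mass at least the absolute difference of its two values.
  · have h1 := sum_pairs_le hab (f := fun i => q i - l)
      fun i => sub_nonneg.2 (hi₀ i (Finset.mem_univ _))
    have h2 : ∑ j, |q (a j) - q (b j)| ≤ ∑ j, ((q (a j) - l) + (q (b j) - l)) :=
      Finset.sum_le_sum fun j _ => by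
        rw [abs_le]
        constructor <;> linarith [hi₀ (a j) (Finset.mem_univ _), hi₀ (b j) (Finset.mem_univ _)]
    rw [Finset.sum_sub_distrib, Finset.sum_const, Finset.card_univ, Fintype.card_fin,
      nsmul_eq_mul] at h1
    linarith

/-- AM-GM for `kl` and `w`: `4 (kl) w ≤ (kl + w)²`. -/
lemma mul_sum_sq_sub_le (hk : 0 < k) (hab : Function.Injective (Sum.elim a b)) {E : ℝ}
    (hE1 : 1 ≤ E) {q : Fin k → ℝ} (h0 : ∀ i, 0 ≤ q i) (hE : ∀ i j, q i ≤ E * q j) :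
    k * ∑ j, (q (a j) - q (b j)) ^ 2 ≤ (E - 1) / 4 * (∑ i, q i) ^ 2 := by
  obtain ⟨l, w, hl, hw, h1, -, h3⟩ := exists_excess hk hab h0 hE
  have hk' : (0 : ℝ) ≤ k := Nat.cast_nonneg k
  have h4 : (k * l + w) ^ 2 ≤ (∑ i, q i) ^ 2 := pow_le_pow_left₀ (by positivity) h3 2
  calc k * ∑ j, (q (a j) - q (b j)) ^ 2 ≤ k * ((E - 1) * l * w) := by gcongr
    _ ≤ (E - 1) / 4 * (k * l + w) ^ 2 := by
      nlinarith [mul_nonneg (sub_nonneg.2 hE1) (sq_nonneg (k * l - w))]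
    _ ≤ _ := mul_le_mul_of_nonneg_left h4 (by linarith)

/-- For `E ≤ 3` the constraint `w ≤ (E - 1) kl / 2` keeps `w ≤ kl`, where `(kl) w / (kl + w)²`
increases with `w / (kl)`. Its value at the extreme ratio `(E - 1) / 2` gives the constant, which
agrees with `(E - 1) / 4` at `E = 3`. -/
lemma mul_sum_sq_sub_le_of_le_three (hk : 0 < k) (hab : Function.Injective (Sum.elim a b)) {E : ℝ}
    (hE1 : 1 ≤ E) (hE3 : E ≤ 3) {q : Fin k → ℝ} (h0 : ∀ i, 0 ≤ q i)
    (hE : ∀ i j, q i ≤ E * q j) :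
    k * ∑ j, (q (a j) - q (b j)) ^ 2 ≤ 2 * (E - 1) ^ 2 / (E + 1) ^ 2 * (∑ i, q i) ^ 2 := by
  obtain ⟨l, w, hl, hw, h1, h2, h3⟩ := exists_excess hk hab h0 hE
  have hk' : (0 : ℝ) ≤ k := Nat.cast_nonneg k
  have h4 : (k * l + w) ^ 2 ≤ (∑ i, q i) ^ 2 := pow_le_pow_left₀ (by positivity) h3 2
  have hc : 0 ≤ E - 1 := by linarith
  have hX : 0 ≤ k * l := by positivity
  -- The product equals `2 (E - 1) (kl + w)² - (E + 1)² (kl) w`.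
  have h5 : 0 ≤ ((E - 1) * (k * l) - 2 * w) * (2 * (k * l) - (E - 1) * w) := by
    refine mul_nonneg (by linarith) ?_
    have h6 : (E - 1) * (2 * w) ≤ 2 * ((E - 1) * l * k) := mul_le_mul (by linarith) h2
      (by positivity) (by norm_num)
    have h7 : (E - 1) * (k * l) ≤ 2 * (k * l) := mul_le_mul_of_nonneg_right (by linarith) hX
    linarith
  calc k * ∑ j, (q (a j) - q (b j)) ^ 2 ≤ k * ((E - 1) * l * w) := by gcongr
    _ ≤ 2 * (E - 1) ^ 2 / (E + 1) ^ 2 * (k * l + w) ^ 2 := by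
      rw [div_mul_eq_mul_div, le_div_iff₀ (by positivity)]
      linarith [mul_nonneg hc h5]
    _ ≤ _ := mul_le_mul_of_nonneg_left h4 (by positivity)

end Pairs

/-! ### The perturbed distributions and Assouad's inequality. -/

section Hypercube

/-- The sign `±1` of a bit. -/
def bitSign (c : Bool) : ℝ := if c then 1 else -1

lemma bitSign_not (c : Bool) : bitSign (!c) = -bitSign c := by cases c <;> simp [bitSign]

lemma abs_bitSign (c : Bool) : |bitSign c| = 1 := by cases c <;> simp [bitSign]

/-- The bit string with bit `j` flipped. -/
def flipAt {m : ℕ} (v : Fin m → Bool) (j : Fin m) : Fin m → Bool := Function.update v j (!v j)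

lemma flipAt_involutive {m : ℕ} (j : Fin m) :
    Function.Involutive fun v : Fin m → Bool => flipAt v j := fun v => by simp [flipAt]

/-- The uniform distribution perturbed by `±δ` along the pairs `(a j, b j)`. -/
noncomputable def perturbed {m k : ℕ} (a b : Fin m → Fin k) (δ : ℝ) (v : Fin m → Bool) :
    Fin k → ℝ :=
  fun i => 1 / k + δ * ∑ j, bitSign (v j) * ((if i = a j then 1 else 0) - if i = b j then 1 else 0)

variable {m k : ℕ} {a b : Fin m → Fin k} {δ : ℝ}

lemma perturbed_left (hab : Function.Injective (Sum.elim a b)) (v : Fin m → Bool) (j : Fin m) :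
    perturbed a b δ v (a j) = 1 / k + δ * bitSign (v j) := by
  have h1 : ∀ i, a j = a i ↔ j = i := fun i =>
    ⟨fun h => Sum.inl.inj (hab (a₁ := .inl j) (a₂ := .inl i) h), fun h => h ▸ rfl⟩
  have h2 : ∀ i, a j ≠ b i := fun i h => Sum.inl_ne_inr (hab (a₁ := .inl j) (a₂ := .inr i) h)
  simp [perturbed, h1, h2]

lemma perturbed_right (hab : Function.Injective (Sum.elim a b)) (v : Fin m → Bool) (j : Fin m) :
    perturbed a b δ v (b j) = 1 / k - δ * bitSign (v j) := by
  have h1 : ∀ i, b j = b i ↔ j = i := fun i =>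
    ⟨fun h => Sum.inr.inj (hab (a₁ := .inr j) (a₂ := .inr i) h), fun h => h ▸ rfl⟩
  have h2 : ∀ i, b j ≠ a i := fun i h => Sum.inr_ne_inl (hab (a₁ := .inr j) (a₂ := .inl i) h)
  simp [perturbed, h1, h2, sub_eq_add_neg]

lemma le_perturbed (hab : Function.Injective (Sum.elim a b)) (hδ : 0 ≤ δ) (v : Fin m → Bool)
    (i : Fin k) : 1 / k - δ ≤ perturbed a b δ v i := by
  have hs : ∀ j, -δ ≤ δ * bitSign (v j) ∧ δ * bitSign (v j) ≤ δ := fun j => by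
    cases v j <;> simp [bitSign] <;> linarith
  by_cases h : ∃ s, Sum.elim a b s = i
  · obtain ⟨j | j, rfl⟩ := h
    · rw [Sum.elim_inl, perturbed_left hab]; linarith [(hs j).1]
    · rw [Sum.elim_inr, perturbed_right hab]; linarith [(hs j).2]
  · have h1 : ∀ j, i ≠ a j := fun j hj => h ⟨.inl j, hj.symm⟩
    have h2 : ∀ j, i ≠ b j := fun j hj => h ⟨.inr j, hj.symm⟩
    simpa [perturbed, h1, h2] using hδ

lemma sum_perturbed_mul (v : Fin m → Bool) (x : Fin k → ℝ) :
    ∑ i, perturbed a b δ v i * x i =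
      (∑ i, x i) / k + δ * ∑ j, bitSign (v j) * (x (a j) - x (b j)) := by
  have h : ∀ i, perturbed a b δ v i * x i = x i / k + δ * ∑ j, bitSign (v j) *
      ((if i = a j then x i else 0) - if i = b j then x i else 0) := fun i => by
    rw [perturbed, add_mul, mul_assoc, Finset.sum_mul]
    congr 1
    · ring
    · congr 1
      refine Finset.sum_congr rfl fun j _ => ?_
      rw [mul_assoc, sub_mul, ite_mul, ite_mul, one_mul, zero_mul]
  simp_rw [h]
  rw [Finset.sum_add_distrib, ← Finset.mul_sum, Finset.sum_comm, ← Finset.sum_div]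
  congr 2
  refine Finset.sum_congr rfl fun j _ => ?_
  rw [← Finset.mul_sum, Finset.sum_sub_distrib]
  simp

lemma perturbed_mem_stdSimplex (hk : 0 < k) (hab : Function.Injective (Sum.elim a b))
    (hδ : 0 ≤ δ) (hδk : δ ≤ 1 / k) (v : Fin m → Bool) :
    perturbed a b δ v ∈ stdSimplex ℝ (Fin k) := by
  refine ⟨fun i => (sub_nonneg.2 hδk).trans (le_perturbed hab hδ v i), ?_⟩
  have hk' : (k : ℝ) ≠ 0 := by positivity
  simpa [hk'] using sum_perturbed_mul (a := a) (b := b) (δ := δ) v (fun _ => 1)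

lemma sum_perturbed_sub_flipAt (v : Fin m → Bool) (j : Fin m) (x : Fin k → ℝ) :
    ∑ i, perturbed a b δ v i * x i - ∑ i, perturbed a b δ (flipAt v j) i * x i =
      2 * δ * bitSign (v j) * (x (a j) - x (b j)) := by
  rw [sum_perturbed_mul, sum_perturbed_mul, add_sub_add_left_eq_sub, ← mul_sub,
    ← Finset.sum_sub_distrib, Finset.sum_eq_single j]
  · simp only [flipAt, Function.update_self, bitSign_not]; ring
  · intro i _ hi
    simp [flipAt, Function.update_of_ne hi]
  · simp

/-- The triangular discriminations between neighbouring perturbed mixtures. -/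
lemma sum_sq_sub_div_le (hk : 0 < k) (hab : Function.Injective (Sum.elim a b)) (hδ : 0 ≤ δ)
    (hδk : δ ≤ 1 / (2 * k)) {A : ℝ} {q : Fin k → ℝ} (h0 : ∀ i, 0 ≤ q i)
    (hA : k * ∑ j, (q (a j) - q (b j)) ^ 2 ≤ A * (∑ i, q i) ^ 2) (v : Fin m → Bool) :
    ∑ j, (∑ i, perturbed a b δ v i * q i - ∑ i, perturbed a b δ (flipAt v j) i * q i) ^ 2 /
        (∑ i, perturbed a b δ v i * q i + ∑ i, perturbed a b δ (flipAt v j) i * q i) ≤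
      4 * δ ^ 2 * A * ∑ i, q i := by
  have hk' : (0 : ℝ) < k := by exact_mod_cast hk
  rcases (Finset.sum_nonneg fun i (_ : i ∈ Finset.univ) => h0 i).eq_or_lt with hs | hs
  · have hq : ∀ i, q i = 0 := fun i =>
      (Finset.sum_eq_zero_iff_of_nonneg fun i _ => h0 i).1 hs.symm i (Finset.mem_univ i)
    simp [hq]
  -- Since `δ ≤ 1 / (2k)`, every coordinate keeps at least half of its uniform weight.
  have hlow : ∀ w, (∑ i, q i) / (2 * k) ≤ ∑ i, perturbed a b δ w i * q i := fun w => by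
    rw [Finset.sum_div]
    refine Finset.sum_le_sum fun i _ => ?_
    have h1 := le_perturbed hab hδ w i
    have h2 : (1 : ℝ) / k = 1 / (2 * k) + 1 / (2 * k) := by field_simp; norm_num
    rw [div_eq_mul_one_div, mul_comm]
    exact mul_le_mul_of_nonneg_right (by linarith) (h0 i)
  have hterm : ∀ j, (∑ i, perturbed a b δ v i * q i -
        ∑ i, perturbed a b δ (flipAt v j) i * q i) ^ 2 /
        (∑ i, perturbed a b δ v i * q i + ∑ i, perturbed a b δ (flipAt v j) i * q i) ≤
      4 * δ ^ 2 / (∑ i, q i) * (k * (q (a j) - q (b j)) ^ 2) := fun j => by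
    have h1 : (∑ i, q i) / k ≤
        ∑ i, perturbed a b δ v i * q i + ∑ i, perturbed a b δ (flipAt v j) i * q i := by
      have h2 : (∑ i, q i) / k = (∑ i, q i) / (2 * k) + (∑ i, q i) / (2 * k) := by
        field_simp; norm_num
      linarith [hlow v, hlow (flipAt v j)]
    rw [sum_perturbed_sub_flipAt]
    refine (div_le_div_of_nonneg_left (sq_nonneg _) (by positivity) h1).trans (le_of_eq ?_)
    have h3 : bitSign (v j) ^ 2 = 1 := by rw [← sq_abs, abs_bitSign, one_pow]
    rw [mul_pow, mul_pow, h3]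
    field_simp
    ring
  refine (Finset.sum_le_sum fun j _ => hterm j).trans ?_
  rw [← Finset.mul_sum, ← Finset.mul_sum, div_mul_eq_mul_div, div_le_iff₀ hs]
  nlinarith [mul_le_mul_of_nonneg_left hA (show 0 ≤ 4 * δ ^ 2 by positivity)]

/-- Assouad's inequality, pointwise: the total loss over the hypercube against nonnegative weights
is bounded below by the overlaps of the weights at neighbouring vertices. -/
lemma le_sum_loss_perturbed (hab : Function.Injective (Sum.elim a b)) (hδ : 0 ≤ δ) {g : ℝ → ℝ}
    {D : ℝ} (hg0 : ∀ x, 0 ≤ g x) (hg : ∀ x y, |x - y| = 2 * δ → D ≤ g x + g y)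
    {P : (Fin m → Bool) → ℝ} (hP : ∀ v, 0 ≤ P v) (u : Fin k → ℝ) :
    D * ∑ v, ∑ j, min (P v) (P (flipAt v j)) ≤
      ∑ v, (∑ i, g (u i - perturbed a b δ v i)) * P v := by
  set L : Fin m → (Fin m → Bool) → ℝ := fun j v =>
    g (u (a j) - perturbed a b δ v (a j)) + g (u (b j) - perturbed a b δ v (b j)) with hL
  have hL0 : ∀ j v, 0 ≤ L j v := fun j v => add_nonneg (hg0 _) (hg0 _)
  have hsep : ∀ j v, 2 * D ≤ L j v + L j (flipAt v j) := fun j v => by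
    have hf : bitSign (flipAt v j j) = -bitSign (v j) := by simp [flipAt, bitSign_not]
    have hs : ∀ c : ℝ, |c| = 1 → |2 * δ * c| = 2 * δ := fun c hc => by
      rw [abs_mul, hc, mul_one, abs_of_nonneg (by linarith)]
    have h1 := hg (u (a j) - perturbed a b δ v (a j)) (u (a j) - perturbed a b δ (flipAt v j) (a j))
      (by rw [perturbed_left hab, perturbed_left hab, hf, ← hs (-bitSign (v j))
            (by rw [abs_neg, abs_bitSign])]; congr 1; ring)
    have h2 := hg (u (b j) - perturbed a b δ v (b j)) (u (b j) - perturbed a b δ (flipAt v j) (b j))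
      (by rw [perturbed_right hab, perturbed_right hab, hf, ← hs (bitSign (v j)) (abs_bitSign _)]
          congr 1; ring)
    simp only [hL]
    linarith
  have hpair : ∀ j, D * ∑ v, min (P v) (P (flipAt v j)) ≤ ∑ v, L j v * P v := fun j => by
    -- Flipping bit `j` permutes the vertices, so pairing each vertex with its neighbour counts the
    -- loss twice.
    have hswap : ∑ v, L j (flipAt v j) * P (flipAt v j) = ∑ v, L j v * P v :=
      Equiv.sum_comp (flipAt_involutive j).toPerm fun v => L j v * P v
    have h : ∑ v, 2 * (D * min (P v) (P (flipAt v j))) ≤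
        ∑ v, (L j v * P v + L j (flipAt v j) * P (flipAt v j)) :=
      Finset.sum_le_sum fun v _ => by
        have hm : 0 ≤ min (P v) (P (flipAt v j)) := le_min (hP _) (hP _)
        have h1 := mul_le_mul_of_nonneg_left (min_le_left (P v) (P (flipAt v j))) (hL0 j v)
        have h2 := mul_le_mul_of_nonneg_left (min_le_right (P v) (P (flipAt v j)))
          (hL0 j (flipAt v j))
        have h3 := mul_le_mul_of_nonneg_right (hsep j v) hm
        linarith
    rw [Finset.sum_add_distrib, hswap, ← Finset.mul_sum, ← Finset.mul_sum] at h
    linarith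
  calc D * ∑ v, ∑ j, min (P v) (P (flipAt v j))
      = ∑ j, D * ∑ v, min (P v) (P (flipAt v j)) := by rw [Finset.sum_comm, Finset.mul_sum]
    _ ≤ ∑ j, ∑ v, L j v * P v := Finset.sum_le_sum fun j _ => hpair j
    _ = ∑ v, (∑ j, L j v) * P v := by
      rw [Finset.sum_comm]; simp_rw [Finset.sum_mul]
    _ ≤ _ := Finset.sum_le_sum fun v _ => mul_le_mul_of_nonneg_right
      (sum_pairs_le hab (f := fun i => g (u i - perturbed a b δ v i)) fun i => hg0 _) (hP v)

end Hypercube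

/-! ### From overlaps to the minimax risk. -/

section Risk

variable {Y : Type*} [MeasurableSpace Y] {μ : Measure Y} {k : ℕ} {q : Fin k → Y → ℝ}

lemma marginal_eq_withDensity {Q : Kernel (Fin k) Y} (hqm : ∀ i, Measurable (q i))
    (hq0 : ∀ i y, 0 ≤ q i y) (hQ : ∀ i, Q i = μ.withDensity fun y => ENNReal.ofReal (q i y))
    {p : Fin k → ℝ} (hp : ∀ i, 0 ≤ p i) :
    marginal Q p = μ.withDensity fun y => ENNReal.ofReal (∑ i, p i * q i y) := by
  ext s hs
  rw [marginal, Measure.finsetSum_apply, withDensity_apply _ hs]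
  have h : ∀ y, ENNReal.ofReal (∑ i, p i * q i y) =
      ∑ i, ENNReal.ofReal (p i) * ENNReal.ofReal (q i y) := fun y => by
    rw [ENNReal.ofReal_sum_of_nonneg fun i _ => mul_nonneg (hp i) (hq0 i y)]
    exact Finset.sum_congr rfl fun i _ => ENNReal.ofReal_mul (hp i)
  simp_rw [h]
  rw [lintegral_finsetSum _ fun i _ => (hqm i).ennreal_ofReal.const_mul _]
  refine Finset.sum_congr rfl fun i _ => ?_
  rw [Measure.smul_apply, hQ, withDensity_apply _ hs, lintegral_const_mul _ (hqm i).ennreal_ofReal,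
    smul_eq_mul]

lemma integrable_of_withDensity_prob (hqm : ∀ i, Measurable (q i)) (hq0 : ∀ i y, 0 ≤ q i y)
    (h : ∀ i, IsProbabilityMeasure (μ.withDensity fun y => ENNReal.ofReal (q i y))) (i : Fin k) :
    Integrable (q i) μ ∧ ∫ y, q i y ∂μ = 1 := by
  have h1 : ∫⁻ y, ENNReal.ofReal (q i y) ∂μ = 1 := by
    rw [← setLIntegral_univ, ← withDensity_apply _ MeasurableSet.univ]
    exact (h i).measure_univ
  have h2 : 0 ≤ᵐ[μ] q i := Filter.Eventually.of_forall (hq0 i)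
  refine ⟨⟨(hqm i).aestronglyMeasurable, (hasFiniteIntegral_iff_ofReal h2).2 (by simp [h1])⟩, ?_⟩
  rw [integral_eq_lintegral_of_nonneg_ae h2 (hqm i).aestronglyMeasurable, h1, ENNReal.toReal_one]

variable {m n : ℕ} {a b : Fin m → Fin k} {δ A D : ℝ} {g : ℝ → ℝ}

/-- Assouad's lower bound for a mechanism whose densities have controlled contrasts. -/
lemma le_minimaxRisk {Q : Kernel (Fin k) Y} [IsMarkovKernel Q] [IsFiniteMeasure μ] (hk : 0 < k)
    (hab : Function.Injective (Sum.elim a b)) (hqm : ∀ i, Measurable (q i))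
    (hq0 : ∀ i y, 0 ≤ q i y) (hQ : ∀ i, Q i = μ.withDensity fun y => ENNReal.ofReal (q i y))
    (hA : ∀ y, k * ∑ j, (q (a j) y - q (b j) y) ^ 2 ≤ A * (∑ i, q i y) ^ 2)
    (hδ : 0 ≤ δ) (hδk : δ ≤ 1 / (2 * k)) (hgm : Measurable g) (hg0 : ∀ x, 0 ≤ g x) (hD : 0 ≤ D)
    (hg : ∀ x y, |x - y| = 2 * δ → D ≤ g x + g y) :
    ENNReal.ofReal (D * (m - n * (4 * δ ^ 2 * A * k)) / 2) ≤
      minimaxRisk n (fun u p => ∑ i, g (u i - p i)) Q := by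
  have hk' : (0 : ℝ) < k := by exact_mod_cast hk
  have hδk' : δ ≤ 1 / k := hδk.trans (one_div_le_one_div_of_le hk' (by linarith))
  have hsimp := perturbed_mem_stdSimplex hk hab hδ hδk'
  have hqi : ∀ i, Integrable (q i) μ ∧ ∫ y, q i y ∂μ = 1 :=
    integrable_of_withDensity_prob hqm hq0 fun i => hQ i ▸ inferInstance
  set f : (Fin m → Bool) → Y → ℝ := fun v y => ∑ i, perturbed a b δ v i * q i y with hf
  have hf0 : ∀ v y, 0 ≤ f v y := fun v y =>
    Finset.sum_nonneg fun i _ => mul_nonneg ((hsimp v).1 i) (hq0 i y)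
  have hfm : ∀ v, Measurable (f v) := fun v =>
    Finset.measurable_fun_sum _ fun i _ => (hqm i).const_mul _
  have hfi : ∀ v, Integrable (f v) μ := fun v =>
    integrable_finsetSum _ fun i _ => (hqi i).1.const_mul _
  have hf1 : ∀ v, ∫ y, f v y ∂μ = 1 := fun v => by
    rw [hf, integral_finsetSum _ fun i _ => (hqi i).1.const_mul _]
    simp_rw [integral_const_mul, (hqi _).2, mul_one]
    exact (hsimp v).2
  set M : Measure (Fin n → Y) := Measure.pi fun _ => μ with hM
  set P : (Fin m → Bool) → (Fin n → Y) → ℝ := fun v y => ∏ t, f v (y t) with hP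
  have hP0 : ∀ v y, 0 ≤ P v y := fun v y => Finset.prod_nonneg fun t _ => hf0 v _
  have hPm : ∀ v, Measurable (P v) := fun v =>
    Finset.measurable_fun_prod _ fun t _ => (hfm v).comp (measurable_pi_apply t)
  have hPi : ∀ v, Integrable (P v) M := fun v => Integrable.fintype_prod fun _ => hfi v
  have hmin : ∀ v j, Integrable (fun y => min (P v y) (P (flipAt v j) y)) M := fun v j =>
    (hPi v).inf (hPi _)
  -- The discriminations are summed over `j` before integrating, because the contrast bound `hA`
  -- controls only their sum; each `q i` integrates to 1, which yields the factor `k`.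
  have hover : ∀ v, (m - n * (4 * δ ^ 2 * A * k)) / 2 ≤
      ∑ j, ∫ y, min (P v y) (P (flipAt v j) y) ∂M := fun v => by
    have h1 : ∑ j, ∫ y, (f v y - f (flipAt v j) y) ^ 2 / (f v y + f (flipAt v j) y) ∂μ ≤
        4 * δ ^ 2 * A * k := by
      rw [← integral_finsetSum _ fun j _ =>
        integrable_sq_sub_div (hf0 v) (hf0 _) (hfi v) (hfi (flipAt v j))]
      refine (integral_mono
        (integrable_finsetSum _ fun j _ =>
          integrable_sq_sub_div (hf0 v) (hf0 _) (hfi v) (hfi (flipAt v j)))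
        ((integrable_finsetSum Finset.univ fun i _ => (hqi i).1).const_mul (4 * δ ^ 2 * A))
        fun y => sum_sq_sub_div_le hk hab hδ hδk (fun i => hq0 i y) (hA y) v).trans (le_of_eq ?_)
      rw [integral_const_mul, integral_finsetSum _ fun i _ => (hqi i).1]
      simp [(hqi _).2]
    have h2 := Finset.sum_le_sum fun j (_ : j ∈ Finset.univ) =>
      le_integral_min_prod n (hf0 v) (hf0 (flipAt v j)) (hfi v) (hfi _) (hf1 v) (hf1 _)
    rw [Finset.sum_sub_distrib, ← Finset.mul_sum, ← Finset.mul_sum, Finset.sum_const,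
      Finset.card_univ, Fintype.card_fin, nsmul_eq_mul, mul_one] at h2
    have h3 := mul_le_mul_of_nonneg_left h1 (Nat.cast_nonneg (α := ℝ) n)
    linarith
  refine le_iInf₂ fun est hest => ?_
  set R := ⨆ p ∈ stdSimplex ℝ (Fin k), expectedLoss (fun u p => ∑ i, g (u i - p i)) Q est p
  have hloss0 : ∀ v y, 0 ≤ ∑ i, g (est y i - perturbed a b δ v i) := fun v y =>
    Finset.sum_nonneg fun i _ => hg0 _
  have hlm : ∀ v, Measurable fun y => ∑ i, g (est y i - perturbed a b δ v i) := fun v =>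
    Finset.measurable_fun_sum _ fun i _ =>
      hgm.comp (((measurable_pi_apply i).comp hest).sub_const _)
  have hexp : ∀ v, expectedLoss (fun u p => ∑ i, g (u i - p i)) Q est (perturbed a b δ v) =
      ∫⁻ y, ENNReal.ofReal ((∑ i, g (est y i - perturbed a b δ v i)) * P v y) ∂M := fun v => by
    rw [expectedLoss, marginal_eq_withDensity hqm hq0 hQ (hsimp v).1,
      pi_withDensity_ofReal μ (hf0 v) (hfi v),
      lintegral_withDensity_eq_lintegral_mul _ (hPm v).ennreal_ofReal (hlm v).ennreal_ofReal]
    refine lintegral_congr fun y => ?_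
    rw [ENNReal.ofReal_mul (hloss0 v y), mul_comm]
    rfl
  have hsum : ENNReal.ofReal (∑ _v : Fin m → Bool, D * (m - n * (4 * δ ^ 2 * A * k)) / 2) ≤
      ∑ _v : Fin m → Bool, R := by
    calc ENNReal.ofReal (∑ _v : Fin m → Bool, D * (m - n * (4 * δ ^ 2 * A * k)) / 2)
        ≤ ENNReal.ofReal (∫ y, D * ∑ v, ∑ j, min (P v y) (P (flipAt v j) y) ∂M) := by
          refine ENNReal.ofReal_le_ofReal ?_
          rw [integral_const_mul, integral_finsetSum _ fun v _ =>
            integrable_finsetSum _ fun j _ => hmin v j, Finset.mul_sum]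
          refine Finset.sum_le_sum fun v _ => ?_
          rw [integral_finsetSum _ fun j _ => hmin v j, mul_div_assoc]
          exact mul_le_mul_of_nonneg_left (hover v) hD
      _ = ∫⁻ y, ENNReal.ofReal (D * ∑ v, ∑ j, min (P v y) (P (flipAt v j) y)) ∂M :=
          ofReal_integral_eq_lintegral_ofReal
            ((integrable_finsetSum _ fun v _ =>
              integrable_finsetSum _ fun j _ => hmin v j).const_mul D)
            (Filter.Eventually.of_forall fun y => mul_nonneg hD <| Finset.sum_nonneg fun v _ =>
              Finset.sum_nonneg fun j _ => le_min (hP0 _ _) (hP0 _ _))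
      _ ≤ ∫⁻ y, ∑ v, ENNReal.ofReal
            ((∑ i, g (est y i - perturbed a b δ v i)) * P v y) ∂M := by
          refine lintegral_mono fun y => ?_
          rw [← ENNReal.ofReal_sum_of_nonneg fun v _ => mul_nonneg (hloss0 v y) (hP0 v y)]
          exact ENNReal.ofReal_le_ofReal
            (le_sum_loss_perturbed hab hδ hg0 hg (P := fun v => P v y) (fun v => hP0 v y) (est y))
      _ = ∑ v, expectedLoss (fun u p => ∑ i, g (u i - p i)) Q est (perturbed a b δ v) := by
          refine (lintegral_finsetSum _ fun v _ =>
            ((hlm v).mul (hPm v)).ennreal_ofReal).trans ?_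
          exact Finset.sum_congr rfl fun v _ => (hexp v).symm
      _ ≤ ∑ _v : Fin m → Bool, R := Finset.sum_le_sum fun v _ =>
          le_iSup₂_of_le (perturbed a b δ v) (hsimp v) le_rfl
  -- Both sides are sums of equal terms over the vertices; cancelling their number replaces the
  -- average risk by the supremum.
  have hcard : ((Fintype.card (Fin m → Bool) : ℕ) : ℝ≥0∞) ≠ 0 := by
    exact_mod_cast Fintype.card_ne_zero
  rw [Finset.sum_const, Finset.sum_const, Finset.card_univ, nsmul_eq_mul, nsmul_eq_mul,
    ENNReal.ofReal_mul (Nat.cast_nonneg _), ENNReal.ofReal_natCast] at hsum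
  exact (ENNReal.mul_le_mul_iff_right hcard (ENNReal.natCast_ne_top _)).1 hsum

/-- Assouad's lower bound for the private minimax risk of a separable loss. `A` bounds the
contrasts of the densities of every private mechanism. -/
lemma le_privateMinimaxRisk {ε : ℝ} (hk : 2 ≤ k)
    (hA : ∀ {m : ℕ} {a b : Fin m → Fin k} {q : Fin k → ℝ}, Function.Injective (Sum.elim a b) →
      (∀ i, 0 ≤ q i) → (∀ i j, q i ≤ Real.exp ε * q j) →
      k * ∑ j, (q (a j) - q (b j)) ^ 2 ≤ A * (∑ i, q i) ^ 2)
    (hδ : 0 ≤ δ) (hδk : δ ≤ 1 / (2 * k)) (hn : n * (4 * δ ^ 2 * A) ≤ 1 / 8) (hgm : Measurable g)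
    (hg0 : ∀ x, 0 ≤ g x) (hD : 0 ≤ D) (hg : ∀ x y, |x - y| = 2 * δ → D ≤ g x + g y) :
    ENNReal.ofReal (D * (k - 1) / 16) ≤
      privateMinimaxRisk.{u} ε k n fun u p => ∑ i, g (u i - p i) := by
  refine le_iInf fun Y => le_iInf fun _ => le_iInf fun Q => le_iInf fun _ => le_iInf fun hQ => ?_
  obtain ⟨μ, q, _, hqm, hq0, hqE, hQq⟩ := exists_density (fun i => Q i) (Real.exp_pos ε).le hQ
  -- Symbol `j` is paired with `m + j`; for odd `k` the last symbol stays unpaired.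
  obtain ⟨m, hm⟩ : ∃ m, m = k / 2 := ⟨_, rfl⟩
  have hab : Function.Injective (Sum.elim (fun j : Fin m => (⟨j, by omega⟩ : Fin k))
      fun j : Fin m => (⟨m + j, by omega⟩ : Fin k)) := by
    rintro (i | i) (j | j) h <;> simp only [Sum.elim_inl, Sum.elim_inr, Fin.mk.injEq] at h
    · exact congrArg Sum.inl (Fin.ext h)
    · omega
    · omega
    · exact congrArg Sum.inr (Fin.ext (by omega))
  refine le_trans (ENNReal.ofReal_le_ofReal ?_) (le_minimaxRisk (n := n) (by omega) hab hqm hq0 hQq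
    (fun y => hA hab (fun i => hq0 i y) fun i j => hqE i j y) hδ hδk hgm hg0 hD hg)
  have h1 : (k : ℝ) ≤ 2 * m + 1 := by exact_mod_cast (by omega : k ≤ 2 * m + 1)
  have h2 : (2 : ℝ) ≤ k := by exact_mod_cast hk
  have h3 : n * (4 * δ ^ 2 * A * k) ≤ 1 / 8 * k := by
    rw [← mul_assoc (n : ℝ)]
    exact mul_le_mul_of_nonneg_right hn (by linarith)
  have h4 : ((k : ℝ) - 1) / 8 ≤ m - n * (4 * δ ^ 2 * A * k) := by linarith
  nlinarith [mul_le_mul_of_nonneg_left h4 hD]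

lemma le_privateMinimaxRisk_lossL2Sq {ε : ℝ} (hk : 2 ≤ k)
    (hA : ∀ {m : ℕ} {a b : Fin m → Fin k} {q : Fin k → ℝ}, Function.Injective (Sum.elim a b) →
      (∀ i, 0 ≤ q i) → (∀ i j, q i ≤ Real.exp ε * q j) →
      k * ∑ j, (q (a j) - q (b j)) ^ 2 ≤ A * (∑ i, q i) ^ 2)
    (hδ : 0 ≤ δ) (hδk : δ ≤ 1 / (2 * k)) (hn : n * (4 * δ ^ 2 * A) ≤ 1 / 8) :
    ENNReal.ofReal ((k - 1) * δ ^ 2 / 8) ≤ privateMinimaxRisk.{u} ε k n lossL2Sq := by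
  have h := le_privateMinimaxRisk.{u} (D := 2 * δ ^ 2) (g := fun x => x ^ 2) hk hA hδ hδk hn
    (by fun_prop) (fun x => sq_nonneg x) (by positivity) fun x y hxy => by
      -- `D = 2δ²` because `x² + y² ≥ (x - y)² / 2`.
      have : (x - y) ^ 2 = (2 * δ) ^ 2 := by rw [← sq_abs, hxy]
      nlinarith [sq_nonneg (x + y)]
  rwa [show 2 * δ ^ 2 * ((k : ℝ) - 1) / 16 = (k - 1) * δ ^ 2 / 8 by ring] at h

lemma le_privateMinimaxRisk_lossL1 {ε : ℝ} (hk : 2 ≤ k)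
    (hA : ∀ {m : ℕ} {a b : Fin m → Fin k} {q : Fin k → ℝ}, Function.Injective (Sum.elim a b) →
      (∀ i, 0 ≤ q i) → (∀ i j, q i ≤ Real.exp ε * q j) →
      k * ∑ j, (q (a j) - q (b j)) ^ 2 ≤ A * (∑ i, q i) ^ 2)
    (hδ : 0 ≤ δ) (hδk : δ ≤ 1 / (2 * k)) (hn : n * (4 * δ ^ 2 * A) ≤ 1 / 8) :
    ENNReal.ofReal ((k - 1) * δ / 8) ≤ privateMinimaxRisk.{u} ε k n lossL1 := by
  have h := le_privateMinimaxRisk.{u} (D := 2 * δ) (g := fun x => |x|) hk hA hδ hδk hn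
    (by fun_prop) (fun x => abs_nonneg x) (by positivity) fun x y hxy => by
      rw [← hxy]; exact abs_sub x y
  rwa [show 2 * δ * ((k : ℝ) - 1) / 16 = (k - 1) * δ / 8 by ring] at h

end Risk

end LocalPrivacy

/-! ### Choice of the perturbation size in the two privacy regimes. -/

theorem mainTheorem1 (ε : ℝ) (hε : 0 < ε) (k n : ℕ) (hk : 1 ≤ k)
    (hn : max ((k : ℝ) ^ 2 * (Real.exp ε + 1) ^ 2 / (16 * (Real.exp ε - 1) ^ 2))
      ((k : ℝ) ^ 2 / (2 * (Real.exp ε - 1))) < (n : ℝ)) :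
    (Real.exp ε < 3 →
      ENNReal.ofReal (((k : ℝ) - 1) * (Real.exp ε + 1) ^ 2 /
          (512 * (n : ℝ) * (Real.exp ε - 1) ^ 2))
        ≤ LocalPrivacy.privateMinimaxRisk.{u} ε k n LocalPrivacy.lossL2Sq ∧
      ENNReal.ofReal (((k : ℝ) - 1) * (Real.exp ε + 1) /
          (64 * Real.sqrt (n : ℝ) * (Real.exp ε - 1)))
        ≤ LocalPrivacy.privateMinimaxRisk.{u} ε k n LocalPrivacy.lossL1) ∧
    (3 ≤ Real.exp ε →
      ENNReal.ofReal (((k : ℝ) - 1) / (64 * (n : ℝ) * (Real.exp ε - 1)))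
        ≤ LocalPrivacy.privateMinimaxRisk.{u} ε k n LocalPrivacy.lossL2Sq ∧
      ENNReal.ofReal (((k : ℝ) - 1) / (16 * Real.sqrt (2 * (n : ℝ) * (Real.exp ε - 1))))
        ≤ LocalPrivacy.privateMinimaxRisk.{u} ε k n LocalPrivacy.lossL1) := by
  rcases hk.eq_or_lt with rfl | hk2
  -- For `k = 1` all four bounds are zero.
  · simp
  have hk0 : 0 < k := hk
  have hkR : (0 : ℝ) < k := by exact_mod_cast hk
  have hE : 1 < Real.exp ε := Real.one_lt_exp_iff.2 hε
  set E := Real.exp ε with hEdef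
  have hc : 0 < E - 1 := sub_pos.2 hE
  have hE1 : 0 < E + 1 := by linarith
  obtain ⟨hn1, hn2⟩ := max_lt_iff.1 hn
  have hn0 : (0 : ℝ) < n := lt_trans (by positivity) hn1
  have hs0 : 0 < √(n : ℝ) := Real.sqrt_pos.2 hn0
  have hs : √(n : ℝ) ^ 2 = n := Real.sq_sqrt hn0.le
  refine ⟨fun h3 => ?_, fun h3 => ?_⟩
  -- This `δ` solves `n * (4 * δ ^ 2 * A) = 1 / 8` for `A = 2 (E - 1)² / (E + 1)²`; the first term
  -- of the maximum in `hn` is what `δ ≤ 1 / (2k)` requires.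
  · obtain ⟨δ, hδ⟩ : ∃ δ, δ = (E + 1) / (8 * √(n : ℝ) * (E - 1)) := ⟨_, rfl⟩
    have hδ0 : 0 ≤ δ := by rw [hδ]; positivity
    have hδ2 : δ ^ 2 = (E + 1) ^ 2 / (64 * n * (E - 1) ^ 2) := by
      rw [hδ, div_pow, mul_pow, mul_pow, hs]; norm_num
    have hδk : δ ≤ 1 / (2 * k) := by
      refine (sq_le_sq₀ hδ0 (by positivity)).1 ?_
      rw [hδ2, div_pow, div_le_div_iff₀ (by positivity) (by positivity)]
      rw [div_lt_iff₀ (by positivity)] at hn1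
      nlinarith
    have hnA : n * (4 * δ ^ 2 * (2 * (E - 1) ^ 2 / (E + 1) ^ 2)) ≤ 1 / 8 := by
      rw [hδ2]
      refine le_of_eq ?_
      field_simp
      norm_num
    have hA : ∀ {m : ℕ} {a b : Fin m → Fin k} {q : Fin k → ℝ},
        Function.Injective (Sum.elim a b) → (∀ i, 0 ≤ q i) → (∀ i j, q i ≤ Real.exp ε * q j) →
        k * ∑ j, (q (a j) - q (b j)) ^ 2 ≤
          2 * (E - 1) ^ 2 / (E + 1) ^ 2 * (∑ i, q i) ^ 2 := fun hab h0 hq =>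
      LocalPrivacy.mul_sum_sq_sub_le_of_le_three hk0 hab hE.le h3.le h0 hq
    constructor
    · have h := LocalPrivacy.le_privateMinimaxRisk_lossL2Sq.{u} hk2 hA hδ0 hδk hnA
      convert h using 2
      rw [hδ2]
      field_simp
      ring
    · have h := LocalPrivacy.le_privateMinimaxRisk_lossL1.{u} hk2 hA hδ0 hδk hnA
      convert h using 2
      rw [hδ]
      field_simp
      ring
  -- The same equation with `A = (E - 1) / 4`; now the second term of the maximum gives `δ ≤ 1 /
  -- (2k)`.
  · obtain ⟨δ, hδ⟩ : ∃ δ, δ = 1 / (2 * √(2 * (n : ℝ) * (E - 1))) := ⟨_, rfl⟩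
    have ht0 : 0 < √(2 * (n : ℝ) * (E - 1)) := Real.sqrt_pos.2 (by positivity)
    have hδ0 : 0 ≤ δ := by rw [hδ]; positivity
    have hδ2 : δ ^ 2 = 1 / (8 * n * (E - 1)) := by
      rw [hδ, div_pow, mul_pow, Real.sq_sqrt (by positivity)]
      congr 1 <;> ring
    have hδk : δ ≤ 1 / (2 * k) := by
      refine (sq_le_sq₀ hδ0 (by positivity)).1 ?_
      rw [hδ2, div_pow, div_le_div_iff₀ (by positivity) (by positivity)]
      rw [div_lt_iff₀ (by positivity)] at hn2
      nlinarith
    have hnA : n * (4 * δ ^ 2 * ((E - 1) / 4)) ≤ 1 / 8 := by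
      rw [hδ2]
      refine le_of_eq ?_
      field_simp
    have hA : ∀ {m : ℕ} {a b : Fin m → Fin k} {q : Fin k → ℝ},
        Function.Injective (Sum.elim a b) → (∀ i, 0 ≤ q i) → (∀ i j, q i ≤ Real.exp ε * q j) →
        k * ∑ j, (q (a j) - q (b j)) ^ 2 ≤ (E - 1) / 4 * (∑ i, q i) ^ 2 := fun hab h0 hq =>
      LocalPrivacy.mul_sum_sq_sub_le hk0 hab hE.le h0 hq
    constructor
    · have h := LocalPrivacy.le_privateMinimaxRisk_lossL2Sq.{u} hk2 hA hδ0 hδk hnA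
      convert h using 2
      rw [hδ2]
      field_simp
      ring
    · have h := LocalPrivacy.le_privateMinimaxRisk_lossL1.{u} hk2 hA hδ0 hδk hnA
      convert h using 2
      rw [hδ]
      field_simp
      ring
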